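/- **Theorem.** Let $\mathrm{Sol}^3$ be $\mathbb{R}^3$ with the Riemannian metric $e^{2z}dx^2+e^{-2z}dy^2+dz^2$. A closed $\mathrm{Sol}^3$-manifold is a compact quotient $\mathrm{Sol}^3/\Gamma$, where $\Gamma$ is a group of isometries of $\mathrm{Sol}^3$ acting freely and properly discontinuously, and a $\mathrm{Sol}^3$-group is a group isomorphic to the fundamental group of a closed $\mathrm{Sol}^3$-manifold. A quadratic unit is a complex number $\alpha$ of degree $2$ over $\mathbb{Q}$ such that $\alpha$ and $\alpha^{-1}$ are algebraic integers. If $X^2-\tau X+\varepsilon$ is its minimal polynomial, then $\bar\alpha=\tau-\alpha$ is its conjugate, and the Galois involution of $\mathbb{Q}(\alpha)$ restricts to the ring automorphism of $\mathbb{Z}[\alpha]$ which carries $\alpha$ to $\bar\alpha$; for an ideal $J$ of $\mathbb{Z}[\alpha]$ let $\bar J$ be the image of $J$ under it. Let $[J]$ denote the isomorphism class of $J$ as a $\mathbb{Z}[\alpha]$-module, and put $\overline{[J]}=[\bar J]$. For a quadratic unit $\alpha$ which is not a root of unity and a nonzero ideal $J$ of $\mathbb{Z}[\alpha]$, let $\pi(\alpha,J)=J\rtimes\mathbb{Z}$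 be the semidirect product of the additive group of $J$ with $\mathbb{Z}$, in which the generator $1\in\mathbb{Z}$ acts on $J$ as multiplication by $\alpha$. Then: 1. For all such $(\alpha,J)$, the group $\pi(\alpha,J)$ is a $\mathrm{Sol}^3$-group. 2. For all such pairs $(\alpha,J)$ and $(\beta,K)$, the groups $\pi(\alpha,J)$ and $\pi(\beta,K)$ are isomorphic if and only if either $\beta\in\{\alpha,\alpha^{-1}\}$ and $[K]=[J]$, or $\beta\in\{\bar\alpha,\bar\alpha^{-1}\}$ and $[K]=\overline{[J]}$. (In each of these cases $\mathbb{Z}[\beta]=\mathbb{Z}[\alpha]$, so that the ideal classes can be compared.) 3. For each such $\alpha$, the groups $\pi(\alpha,J)$, where $J$ ranges over the nonzero ideals of $\mathbb{Z}[\alpha]$, fall into finitely many isomorphism classes. -/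

import Mathlib

open scoped ContDiff

/-! ### The geometry Sol³ and its closed manifolds -/

/-- The underlying manifold `ℝ³` of Sol³, with coordinates `(x, y, z)`. -/
abbrev Sol3 : Type := ℝ × ℝ × ℝ

namespace Sol3

/-- The left-invariant Riemannian metric `e^{2z} dx² + e^{-2z} dy² + dz²` of Sol³, evaluated
on two tangent vectors `v`, `w` at the point `p`. -/
noncomputable def metric (p v w : Sol3) : ℝ :=
  Real.exp (2 * p.2.2) * (v.1 * w.1) + Real.exp (-2 * p.2.2) * (v.2.1 * w.2.1) + v.2.2 * w.2.2

/-- `Isom(Sol³)`: the group of all diffeomorphisms of Sol³ which preserve the metric. -/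
noncomputable def Isom : Subgroup (Equiv.Perm Sol3) where
  carrier := {f | ContDiff ℝ ∞ (f : Sol3 → Sol3) ∧ ContDiff ℝ ∞ (f.symm : Sol3 → Sol3) ∧
    ∀ p v w : Sol3, metric (f p) (fderiv ℝ f p v) (fderiv ℝ f p w) = metric p v w}
  one_mem' := by
    refine ⟨contDiff_id, contDiff_id, fun p v w => ?_⟩
    have h : fderiv ℝ ((1 : Equiv.Perm Sol3) : Sol3 → Sol3) p = ContinuousLinearMap.id ℝ Sol3 :=
      fderiv_id
    rw [h]; rfl
  mul_mem' := by
    rintro f g ⟨hf, hf', hfm⟩ ⟨hg, hg', hgm⟩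
    refine ⟨hf.comp hg, hg'.comp hf', fun p v w => ?_⟩
    have h : fderiv ℝ ((f * g : Equiv.Perm Sol3) : Sol3 → Sol3) p
        = (fderiv ℝ f (g p)).comp (fderiv ℝ g p) :=
      fderiv_comp p (hf.differentiable (by simp) _) (hg.differentiable (by simp) _)
    rw [h]
    exact (hfm (g p) _ _).trans (hgm p v w)
  inv_mem' := by
    rintro f ⟨hf, hf', hfm⟩
    refine ⟨hf', hf, fun p v w => ?_⟩
    have h : (fderiv ℝ f (f.symm p)).comp (fderiv ℝ f.symm p) = ContinuousLinearMap.id ℝ Sol3 := by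
      rw [← fderiv_comp p (hf.differentiable (by simp) _) (hf'.differentiable (by simp) _)]
      have : (f : Sol3 → Sol3) ∘ (f.symm : Sol3 → Sol3) = id := by
        ext1 x; simp
      rw [this]; exact fderiv_id
    have hv : ∀ u, fderiv ℝ f (f.symm p) (fderiv ℝ f.symm p u) = u := fun u => by
      simpa using congrArg (fun L => L u) h
    have := hfm (f.symm p) (fderiv ℝ f.symm p v) (fderiv ℝ f.symm p w)
    rw [hv, hv, Equiv.apply_symm_apply] at this
    exact this.symm

end Sol3

/-- `M` is a closed Sol³-manifold: it is (homeomorphic to) the quotient of Sol³ by a group `Γ` of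
isometries of Sol³ which acts freely and properly discontinuously with compact quotient. -/
def IsClosedSol3Manifold (M : Type) [TopologicalSpace M] : Prop :=
  ∃ Γ : Subgroup (Equiv.Perm Sol3), Γ ≤ Sol3.Isom ∧
    ProperlyDiscontinuousSMul Γ Sol3 ∧
    (∀ γ : Γ, γ ≠ 1 → ∀ p : Sol3, γ • p ≠ p) ∧
    CompactSpace (MulAction.orbitRel.Quotient Γ Sol3) ∧
    Nonempty (M ≃ₜ MulAction.orbitRel.Quotient Γ Sol3)

/-- A Sol³-group is a group isomorphic to the fundamental group of a closed Sol³-manifold. -/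
def IsSol3Group (G : Type*) [Group G] : Prop :=
  ∃ (M : Type) (_ : TopologicalSpace M) (x : M),
    IsClosedSol3Manifold M ∧ Nonempty (G ≃* FundamentalGroup M x)

/-! ### Quadratic units -/

/-- `α` is a unit of the ring of algebraic integers, of degree two over `ℚ`. -/
structure IsQuadraticUnit (α : ℂ) : Prop where
  isIntegral : IsIntegral ℤ α
  isIntegral_inv : IsIntegral ℤ α⁻¹
  natDegree_minpoly : (minpoly ℚ α).natDegree = 2

/-- The ring `ℤ[α]`. -/
abbrev ZAdjoin (α : ℂ) : Subalgebra ℤ ℂ := Algebra.adjoin ℤ {α}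

namespace IsQuadraticUnit

variable {α : ℂ}

theorem ne_zero (hα : IsQuadraticUnit α) : α ≠ 0 := by
  rintro rfl
  have h := hα.natDegree_minpoly
  rw [minpoly.zero, Polynomial.natDegree_X] at h
  omega

theorem inv_mem (hα : IsQuadraticUnit α) : α⁻¹ ∈ ZAdjoin α := by
  obtain ⟨p, hp, h0⟩ := hα.isIntegral_inv
  have hα0 := hα.ne_zero
  let _ : Invertible α⁻¹ := invertibleOfNonzero (inv_ne_zero hα0)
  have h1 : Polynomial.aeval α p.reverse = 0 := by
    have h := (Polynomial.eval₂_reverse_eq_zero_iff (algebraMap ℤ ℂ) α⁻¹ p).2 h0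
    rwa [invOf_eq_inv, inv_inv] at h
  have h2 : α * Polynomial.aeval α p.reverse.divX + 1 = 0 := by
    have h := congrArg (Polynomial.aeval α) (Polynomial.X_mul_divX_add p.reverse)
    rw [h1] at h
    simpa [Polynomial.coeff_zero_reverse, hp.leadingCoeff] using h
  have h3 : α⁻¹ = -Polynomial.aeval α p.reverse.divX := by
    field_simp
    linear_combination h2
  rw [h3]
  exact neg_mem (Polynomial.aeval_mem_adjoin_singleton ℤ α)

/-- `α` as an element of `ℤ[α]`. -/
def gen (_ : IsQuadraticUnit α) : ZAdjoin α := ⟨α, Algebra.self_mem_adjoin_singleton ℤ α⟩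

/-- `α` as a unit of `ℤ[α]`. -/
noncomputable def unit (hα : IsQuadraticUnit α) : (ZAdjoin α)ˣ where
  val := hα.gen
  inv := ⟨α⁻¹, hα.inv_mem⟩
  val_inv := Subtype.ext (mul_inv_cancel₀ hα.ne_zero)
  inv_val := Subtype.ext (inv_mul_cancel₀ hα.ne_zero)

/-- The trace `τ` of `α`, whose minimal polynomial is `X² - τ X + ε`. -/
noncomputable def trace (_ : IsQuadraticUnit α) : ℤ := -(minpoly ℤ α).coeff 1

theorem natDegree_minpoly_int (hα : IsQuadraticUnit α) : (minpoly ℤ α).natDegree = 2 := by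
  have h := hα.natDegree_minpoly
  rwa [minpoly.isIntegrallyClosed_eq_field_fractions' ℚ hα.isIntegral,
    (minpoly.monic hα.isIntegral).natDegree_map] at h

theorem minpoly_eq (hα : IsQuadraticUnit α) :
    minpoly ℤ α = Polynomial.X ^ 2 - Polynomial.C hα.trace * Polynomial.X
      + Polynomial.C ((minpoly ℤ α).coeff 0) := by
  have hm := (minpoly.monic hα.isIntegral).coeff_natDegree
  rw [hα.natDegree_minpoly_int] at hm
  have h := Polynomial.as_sum_range_C_mul_X_pow (minpoly ℤ α)
  rw [hα.natDegree_minpoly_int] at h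
  simp only [Finset.sum_range_succ, Finset.sum_range_zero, hm] at h
  conv_lhs => rw [h]
  simp only [trace, map_neg, map_one]
  ring

theorem gen_sq (hα : IsQuadraticUnit α) :
    hα.gen ^ 2 - (hα.trace : ZAdjoin α) * hα.gen + ((minpoly ℤ α).coeff 0 : ZAdjoin α) = 0 := by
  have h := minpoly.aeval ℤ α
  rw [hα.minpoly_eq] at h
  apply Subtype.ext
  simpa [gen] using h

theorem aeval_conj (hα : IsQuadraticUnit α) :
    Polynomial.aeval ((hα.trace : ZAdjoin α) - hα.gen)
      (minpoly ℤ (Algebra.adjoin.powerBasis' hα.isIntegral).gen) = 0 := by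
  have hg : (Algebra.adjoin.powerBasis' hα.isIntegral).gen = hα.gen :=
    Algebra.adjoin.powerBasis'_gen _
  have hm : minpoly ℤ α = minpoly ℤ hα.gen :=
    minpoly.algebraMap_eq (A := ℤ) (B := ZAdjoin α) (B' := ℂ) Subtype.val_injective hα.gen
  rw [hg, ← hm, hα.minpoly_eq]
  have h := hα.gen_sq
  simp only [map_add, map_sub, map_mul, map_pow, Polynomial.aeval_X, eq_intCast,
    map_intCast]
  linear_combination h

/-- The ring endomorphism of `ℤ[α]` which carries `α` to `τ - α`. -/
noncomputable def conjHom (hα : IsQuadraticUnit α) : ZAdjoin α →ₐ[ℤ] ZAdjoin α :=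
  (Algebra.adjoin.powerBasis' hα.isIntegral).lift ((hα.trace : ZAdjoin α) - hα.gen) hα.aeval_conj

theorem conjHom_gen (hα : IsQuadraticUnit α) :
    hα.conjHom hα.gen = (hα.trace : ZAdjoin α) - hα.gen := by
  have h := (Algebra.adjoin.powerBasis' hα.isIntegral).lift_gen _ hα.aeval_conj
  rwa [Algebra.adjoin.powerBasis'_gen] at h

theorem conjHom_comp_self (hα : IsQuadraticUnit α) :
    hα.conjHom.comp hα.conjHom = AlgHom.id ℤ (ZAdjoin α) := by
  apply (Algebra.adjoin.powerBasis' hα.isIntegral).algHom_ext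
  have hg : (Algebra.adjoin.powerBasis' hα.isIntegral).gen = hα.gen :=
    Algebra.adjoin.powerBasis'_gen _
  rw [hg, AlgHom.comp_apply, conjHom_gen, map_sub, map_intCast, conjHom_gen]
  simp

/-- The Galois involution of `ℚ(α)`, restricted to `ℤ[α]`: the automorphism of the ring `ℤ[α]`
which carries `α` to its conjugate `ᾱ = τ - α`. -/
noncomputable def conj (hα : IsQuadraticUnit α) : ZAdjoin α ≃ₐ[ℤ] ZAdjoin α :=
  AlgEquiv.ofAlgHom hα.conjHom hα.conjHom hα.conjHom_comp_self hα.conjHom_comp_self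

theorem conj_gen (hα : IsQuadraticUnit α) :
    hα.conj hα.gen = (hα.trace : ZAdjoin α) - hα.gen := hα.conjHom_gen

/-- The Galois conjugate `ᾱ` of `α`, as a complex number. -/
noncomputable def conjRoot (hα : IsQuadraticUnit α) : ℂ := (hα.conj hα.gen : ZAdjoin α)

/-- The action of `ℤ` on the additive group of `J` in which `n` acts by multiplication by `α ^ n`. -/
noncomputable def action (hα : IsQuadraticUnit α) (J : Ideal (ZAdjoin α)) :
    Multiplicative ℤ →* MulAut (Multiplicative J) :=
  ((MulAutMultiplicative J).symm.toMonoidHom.comp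
    (DistribMulAction.toAddAut (ZAdjoin α)ˣ J)).comp (zpowersHom (ZAdjoin α)ˣ hα.unit)

theorem action_apply (hα : IsQuadraticUnit α) (J : Ideal (ZAdjoin α)) (n : ℤ) (j : J) :
    hα.action J (Multiplicative.ofAdd n) (Multiplicative.ofAdd j)
      = Multiplicative.ofAdd (hα.unit ^ n • j) := rfl

/-- The semidirect product `π = J ⋊ ℤ`, where `ℤ` acts by multiplication by `α`. -/
abbrev SolGroup (hα : IsQuadraticUnit α) (J : Ideal (ZAdjoin α)) : Type :=
  Multiplicative J ⋊[hα.action J] Multiplicative ℤ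

/-- For a fixed `α`, isomorphism of the groups `J ⋊ ℤ`, as an equivalence relation on the nonzero
ideals `J` of `ℤ[α]`. -/
def solGroupSetoid (hα : IsQuadraticUnit α) : Setoid {J : Ideal (ZAdjoin α) // J ≠ ⊥} where
  r J K := Nonempty (hα.SolGroup J.1 ≃* hα.SolGroup K.1)
  iseqv :=
    ⟨fun _ => ⟨MulEquiv.refl _⟩, fun ⟨e⟩ => ⟨e.symm⟩, fun ⟨e⟩ ⟨f⟩ => ⟨e.trans f⟩⟩

end IsQuadraticUnit

/-- `[K] = [J]` for an ideal `K` of `ℤ[β]` and an ideal `J` of `ℤ[α]`: the two rings are the same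
subring of `ℂ`, and `K` and `J` are isomorphic as modules over it. -/
def SameIdealClass {α β : ℂ} (K : Ideal (ZAdjoin β)) (J : Ideal (ZAdjoin α)) : Prop :=
  ∃ h : ZAdjoin α = ZAdjoin β,
    Nonempty (K.comap (Subalgebra.equivOfEq (ZAdjoin α) (ZAdjoin β) h) ≃ₗ[ZAdjoin α] J)

/-! The group is geometric because `α` is hyperbolic. If the discriminant `τ² - 4ε` were not
positive, `α` would be a root of unity (`discrim_pos`), so `α` and its conjugate are real numbers
`a`, `b` with `ab = ε = ±1` and `|a| ≠ 1`. The two real embeddings make `J` a lattice in `ℝ²` on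
which `α` acts as `diag(a, b)`. Letting `J` translate the `(x, y)`-plane and the generator of `ℤ`
act by `diag(a, b)` together with the shift `z ↦ z - log|a|` gives a free, properly discontinuous,
cocompact action by isometries. As Sol³ is simply connected, the quotient has fundamental group `J ⋊
ℤ` (`isSol3Group`).

For the classification, `J` is recovered from the group: every homomorphism to `ℤ` kills it, since
the minimal polynomial of `α` does not vanish at `1` (`map_inl_eq_one`). An isomorphism therefore
restricts to `J ≃ K` and induces `±1` on `ℤ`, so it carries multiplication by `α` to multiplication
by `β` or `β⁻¹` (`equivariantIso_of_mulEquiv`). This number satisfies the quadratic equation of `α`,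
hence is `α` or its conjugate. In the first case `J ≃ K` is `ℤ[α]`-linear; in the second it becomes
so after the Galois involution.

Finiteness is that of the isomorphism classes of ideals. As `ℤ[α]` need not be a maximal order and
its ideals need not be invertible, the approximation argument behind finiteness of class numbers is
run on ideals directly: each is isomorphic to one containing a fixed integer `M ≠ 0`. -/

namespace IsQuadraticUnit

/-! ### Arithmetic of `ℤ[α]`: norm, conjugation and reality. -/

variable {α : ℂ}

/-- The norm `ε` of `α`, whose minimal polynomial is `X² - τ X + ε`. -/
noncomputable def nrm (_ : IsQuadraticUnit α) : ℤ := (minpoly ℤ α).coeff 0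

theorem gen_sq_eq (hα : IsQuadraticUnit α) :
    hα.gen ^ 2 = (hα.trace : ZAdjoin α) * hα.gen - (hα.nrm : ZAdjoin α) := by
  have h := hα.gen_sq
  rw [nrm]
  linear_combination h

theorem coe_gen (hα : IsQuadraticUnit α) : (hα.gen : ℂ) = α := rfl

theorem sq_eq (hα : IsQuadraticUnit α) : α ^ 2 = hα.trace * α - hα.nrm := by
  have h := congrArg (Subtype.val : ZAdjoin α → ℂ) hα.gen_sq_eq
  simpa [coe_gen] using h

theorem conjRoot_eq (hα : IsQuadraticUnit α) : hα.conjRoot = hα.trace - α := by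
  rw [conjRoot, conj_gen]; simp [coe_gen]

theorem exists_eq_add_mul_gen (hα : IsQuadraticUnit α) (x : ZAdjoin α) :
    ∃ m n : ℤ, x = m + n * hα.gen := by
  obtain ⟨x, hx⟩ := x
  suffices h : ∃ m n : ℤ, x = m + n * α by
    obtain ⟨m, n, h⟩ := h
    exact ⟨m, n, Subtype.ext (by simpa [coe_gen] using h)⟩
  induction hx using Algebra.adjoin_induction with
  | mem x hx => exact ⟨0, 1, by simpa using hx⟩
  | algebraMap r => exact ⟨r, 0, by simp⟩
  | add x y _ _ hx hy =>
    obtain ⟨m, n, rfl⟩ := hx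
    obtain ⟨k, l, rfl⟩ := hy
    exact ⟨m + k, n + l, by push_cast; ring⟩
  | mul x y _ _ hx hy =>
    obtain ⟨m, n, rfl⟩ := hx
    obtain ⟨k, l, rfl⟩ := hy
    refine ⟨m * k - n * l * hα.nrm, m * l + n * k + n * l * hα.trace, ?_⟩
    push_cast
    linear_combination (n * l : ℂ) * hα.sq_eq

theorem ne_ratCast (hα : IsQuadraticUnit α) (q : ℚ) : α ≠ q := by
  rintro rfl
  have h := hα.natDegree_minpoly
  have : minpoly ℚ ((algebraMap ℚ ℂ) q) = _ := minpoly.eq_X_sub_C ℂ q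
  simp at this
  rw [this] at h
  simp at h

theorem eq_zero_of_add_mul_eq_zero (hα : IsQuadraticUnit α) {m n : ℤ}
    (h : (m : ℂ) + n * α = 0) : m = 0 ∧ n = 0 := by
  have hn : n = 0 := by
    by_contra hn
    have hn' : (n : ℂ) ≠ 0 := by exact_mod_cast hn
    apply hα.ne_ratCast (-m / n)
    push_cast
    field_simp
    linear_combination h
  subst hn
  simpa using h

theorem conj_conj (hα : IsQuadraticUnit α) (x : ZAdjoin α) : hα.conj (hα.conj x) = x :=
  DFunLike.congr_fun hα.conjHom_comp_self x

theorem gen_mul_conj_gen (hα : IsQuadraticUnit α) : hα.gen * hα.conj hα.gen = hα.nrm := by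
  rw [conj_gen]
  linear_combination -hα.gen_sq_eq

theorem exists_mul_conj_eq (hα : IsQuadraticUnit α) (x : ZAdjoin α) :
    ∃ N : ℤ, x * hα.conj x = N := by
  obtain ⟨m, n, rfl⟩ := hα.exists_eq_add_mul_gen x
  refine ⟨m ^ 2 + m * n * hα.trace + n ^ 2 * hα.nrm, ?_⟩
  have h := hα.gen_mul_conj_gen
  simp only [map_add, map_mul, map_intCast]
  rw [conj_gen] at h ⊢
  push_cast
  linear_combination (n ^ 2 : ZAdjoin α) * h

/-- Both `α` and its conjugate are units of `ℤ[α]`, hence so is `ε`. If `m + nα` is its inverse,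
independence of `1` and `α` gives `εm = 1` already in `ℤ`. -/
theorem isUnit_nrm (hα : IsQuadraticUnit α) : IsUnit hα.nrm := by
  have h : IsUnit (hα.nrm : ZAdjoin α) := by
    rw [← gen_mul_conj_gen]
    exact hα.unit.isUnit.mul (hα.unit.isUnit.map hα.conj)
  obtain ⟨x, hx⟩ := h.exists_right_inv
  obtain ⟨m, n, rfl⟩ := hα.exists_eq_add_mul_gen x
  have h := congrArg (Subtype.val : ZAdjoin α → ℂ) hx
  have h1 : ((hα.nrm * m - 1 : ℤ) : ℂ) + (hα.nrm * n : ℤ) * α = 0 := by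
    have h : (hα.nrm : ℂ) * (m + n * α) = 1 := by simpa [coe_gen] using h
    push_cast
    linear_combination h
  have h2 := (hα.eq_zero_of_add_mul_eq_zero h1).1
  exact IsUnit.of_mul_eq_one m (by linarith)

theorem nrm_eq (hα : IsQuadraticUnit α) : hα.nrm = 1 ∨ hα.nrm = -1 :=
  Int.isUnit_iff.1 hα.isUnit_nrm

/-- The norm of a nonzero element of `J` serves. Thus `J` contains some `N ℤ[α]`, which makes it
cocompact in the plane. -/
theorem exists_int_mem (hα : IsQuadraticUnit α) {J : Ideal (ZAdjoin α)} (hJ : J ≠ ⊥) :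
    ∃ N : ℤ, N ≠ 0 ∧ (N : ZAdjoin α) ∈ J := by
  obtain ⟨x, hx, hx0⟩ := J.ne_bot_iff.1 hJ
  obtain ⟨N, hN⟩ := hα.exists_mul_conj_eq x
  refine ⟨N, ?_, hN ▸ J.mul_mem_right _ hx⟩
  rintro rfl
  rw [Int.cast_zero, mul_eq_zero, map_eq_zero_iff _ hα.conj.injective] at hN
  exact hx0 (hN.elim id id)

/-- The discriminant of a quadratic unit which is not a root of unity is positive. -/
theorem discrim_pos (hα : IsQuadraticUnit α) (h1 : ∀ n : ℕ, 0 < n → α ^ n ≠ 1) :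
    0 < hα.trace ^ 2 - 4 * hα.nrm := by
  by_contra! h
  have hs := hα.sq_eq
  rcases hα.nrm_eq with hn | hn
  · rw [hn] at h hs
    -- Here `ε = 1` and `τ² ≤ 4`. The traces `-2, -1, 0, 1, 2` force `αⁿ = 1` for `n = 2, 3, 4, 6,
    -- 1` respectively.
    have hl : -2 ≤ hα.trace := by nlinarith
    have hu : hα.trace ≤ 2 := by nlinarith
    push_cast at hs
    generalize hα.trace = t at *
    interval_cases t <;> push_cast at hs
    · have : (α + 1) ^ 2 = 0 := by linear_combination hs
      have : α = -1 := by linear_combination pow_eq_zero_iff (two_ne_zero) |>.1 this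
      exact h1 2 two_pos (by rw [this]; norm_num)
    · exact h1 3 three_pos (by linear_combination (α - 1) * hs)
    · exact h1 4 four_pos (by linear_combination (α ^ 2 - 1) * hs)
    · exact h1 6 (by norm_num) (by linear_combination (α + 1) * (α ^ 3 - 1) * hs)
    · have : (α - 1) ^ 2 = 0 := by linear_combination hs
      have : α = 1 := by linear_combination pow_eq_zero_iff (two_ne_zero) |>.1 this
      exact h1 1 one_pos (by rw [this]; norm_num)
  · rw [hn] at h
    nlinarith

/-- A quadratic unit which is not a root of unity is a real number. -/
theorem exists_real (hα : IsQuadraticUnit α) (h1 : ∀ n : ℕ, 0 < n → α ^ n ≠ 1) :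
    ∃ a : ℝ, (a : ℂ) = α := by
  have hD := hα.discrim_pos h1
  have hD' : (0 : ℝ) ≤ ((hα.trace ^ 2 - 4 * hα.nrm : ℤ) : ℝ) := by exact_mod_cast hD.le
  set s := √((hα.trace ^ 2 - 4 * hα.nrm : ℤ) : ℝ) with hs
  have hsq : (s : ℂ) ^ 2 = hα.trace ^ 2 - 4 * hα.nrm := by
    have := Real.sq_sqrt hD'
    rw [← hs] at this
    exact_mod_cast congrArg (fun x : ℝ => (x : ℂ)) this
  have h : (2 * α - hα.trace - s) * (2 * α - hα.trace + s) = 0 := by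
    linear_combination 4 * hα.sq_eq - hsq
  rcases mul_eq_zero.1 h with h | h
  · refine ⟨(hα.trace + s) / 2, ?_⟩
    push_cast
    linear_combination -h / 2
  · refine ⟨(hα.trace - s) / 2, ?_⟩
    push_cast
    linear_combination -h / 2

end IsQuadraticUnit

/-! ### Isometric actions on Sol³ and their quotients. -/

/-- A diagonal affine map of Sol³ is an isometry when its linear part matches its vertical
translation. -/
theorem Sol3.metric_fderiv_diagonal {A B e : ℝ} (c d : ℝ) (hA : Real.exp (2 * e) * A ^ 2 = 1)
    (hB : Real.exp (-2 * e) * B ^ 2 = 1) (p v w : Sol3) :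
    let f : Sol3 → Sol3 := fun p => (A * p.1 + c, B * p.2.1 + d, p.2.2 + e)
    Sol3.metric (f p) (fderiv ℝ f p v) (fderiv ℝ f p w) = Sol3.metric p v w := by
  intro f
  have hf : HasFDerivAt f ((A • ContinuousLinearMap.fst ℝ ℝ (ℝ × ℝ)).prod
      ((B • (ContinuousLinearMap.fst ℝ ℝ ℝ).comp (ContinuousLinearMap.snd ℝ ℝ (ℝ × ℝ))).prod
        ((ContinuousLinearMap.snd ℝ ℝ ℝ).comp (ContinuousLinearMap.snd ℝ ℝ (ℝ × ℝ))))) p := by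
    refine HasFDerivAt.prodMk ?_ (HasFDerivAt.prodMk ?_ ?_)
    · exact ((hasFDerivAt_fst (𝕜 := ℝ)).const_mul A).add_const c
    · exact (((hasFDerivAt_fst (𝕜 := ℝ)).comp p hasFDerivAt_snd).const_mul B).add_const d
    · exact ((hasFDerivAt_snd (𝕜 := ℝ)).comp p hasFDerivAt_snd).add_const e
  have h1 : ∀ x : ℝ, Real.exp (2 * (x + e)) = Real.exp (2 * x) * Real.exp (2 * e) := fun x => by
    rw [← Real.exp_add]; ring_nf
  have h2 : ∀ x : ℝ, Real.exp (-2 * (x + e)) = Real.exp (-2 * x) * Real.exp (-2 * e) :=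
    fun x => by rw [← Real.exp_add]; ring_nf
  rw [hf.fderiv]
  simp only [Sol3.metric, f, h1, h2, ContinuousLinearMap.prod_apply, _root_.smul_apply,
    ContinuousLinearMap.comp_apply, ContinuousLinearMap.coe_fst', ContinuousLinearMap.coe_snd',
    smul_eq_mul]
  linear_combination Real.exp (2 * p.2.2) * v.1 * w.1 * hA
    + Real.exp (-2 * p.2.2) * v.2.1 * w.2.1 * hB

/-- A closed Sol³-manifold obtained from a faithful action on Sol³ has the acting group as its
fundamental group. -/
theorem isSol3Group_of_hom {G : Type*} [Group G] (φ : G →* Equiv.Perm Sol3)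
    (hisom : ∀ g, φ g ∈ Sol3.Isom)
    (hfree : ∀ g p, φ g p = p → g = 1)
    (hdisc : ∀ C : ℝ, {g : G | ∃ p : Sol3, ‖p‖ ≤ C ∧ ‖φ g p‖ ≤ C}.Finite)
    (hcpt : ∃ C : ℝ, ∀ p : Sol3, ∃ g, ‖φ g p‖ ≤ C) : IsSol3Group G := by
  have hinj : Function.Injective φ := (injective_iff_map_eq_one φ).2 fun g hg =>
    hfree g 0 (by rw [hg]; rfl)
  have hle : φ.range ≤ Sol3.Isom := by
    rintro _ ⟨g, rfl⟩
    exact hisom g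
  have hfree' : ∀ γ : φ.range, ∀ p : Sol3, γ • p = p → γ = 1 := by
    rintro ⟨_, g, rfl⟩ p hp
    have : g = 1 := hfree g p hp
    subst this
    exact Subtype.ext (map_one φ)
  have hpd : ProperlyDiscontinuousSMul φ.range Sol3 := by
    refine ⟨fun {K L} hK hL => ?_⟩
    obtain ⟨C, hC⟩ := hK.isBounded.exists_norm_le
    obtain ⟨D, hD⟩ := hL.isBounded.exists_norm_le
    refine ((hdisc (max C D)).image φ.rangeRestrict).subset ?_
    rintro ⟨_, g, rfl⟩ ⟨_, ⟨p, hp, rfl⟩, hL⟩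
    exact ⟨g, ⟨p, (hC p hp).trans (le_max_left _ _), (hD _ hL).trans (le_max_right _ _)⟩, rfl⟩
  have hcompact : CompactSpace (MulAction.orbitRel.Quotient φ.range Sol3) := by
    obtain ⟨C, hC⟩ := hcpt
    have hK : IsCompact (Metric.closedBall (0 : Sol3) C) := isCompact_closedBall _ _
    refine ⟨?_⟩
    convert hK.image (f := (Quotient.mk'' : Sol3 → MulAction.orbitRel.Quotient φ.range Sol3))
      continuous_quotient_mk'
    refine (Set.eq_univ_of_forall fun x => ?_).symm
    obtain ⟨p, rfl⟩ := Quotient.exists_rep x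
    obtain ⟨g, hg⟩ := hC p
    exact ⟨φ g p, by simpa using hg, Quotient.sound ⟨⟨φ g, g, rfl⟩, rfl⟩⟩
  have hcont : ContinuousConstSMul φ.range Sol3 := ⟨fun γ => (hle γ.2).1.continuous⟩
  have hcancel : IsCancelSMul φ.range Sol3 := isCancelSMul_iff_eq_one_of_smul_eq.2 hfree'
  have hcov := isQuotientCoveringMap_quotientMk_of_properlyDiscontinuousSMul
    (G := φ.range) (E := Sol3)
  let π : Sol3 → MulAction.orbitRel.Quotient φ.range Sol3 :=
    Quotient.mk (MulAction.orbitRel φ.range Sol3)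
  refine ⟨MulAction.orbitRel.Quotient φ.range Sol3, inferInstance, π 0,
    ⟨φ.range, hle, hpd, fun γ h p hp => h (hfree' γ p hp), hcompact, ⟨Homeomorph.refl _⟩⟩, ⟨?_⟩⟩
  -- The covering by the simply connected Sol³ identifies the fundamental group with the opposite of
  -- the acting group; inversion compensates for the opposite.
  exact (MonoidHom.ofInjective hinj).trans ((MulEquiv.inv' φ.range).trans
    (hcov.fundamentalGroupEquiv (x := π 0) ⟨0, rfl⟩).symm)

/-! ### The action of `J ⋊ ℤ` on Sol³. -/

namespace IsQuadraticUnit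

variable {α : ℂ}

/-- The target is an arbitrary field so that this covers both the real embeddings of `J` and the
maps `J → K → ℂ` of the classification. -/
theorem map_unit_zpow_smul (hα : IsQuadraticUnit α) {F : Type*} [Field F]
    {J : Ideal (ZAdjoin α)} (s : J →+ F) {a : F}
    (ha : a ≠ 0) (hs : ∀ j : J, s (hα.gen • j) = a * s j) (n : ℤ) (j : J) :
    s (hα.unit ^ n • j) = a ^ n * s j := by
  have h1 : ∀ j : J, s (hα.unit • j) = a * s j := hs
  have h2 : ∀ j : J, s (hα.unit⁻¹ • j) = a⁻¹ * s j := fun j => by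
    have := h1 (hα.unit⁻¹ • j)
    rw [smul_inv_smul] at this
    rw [this, inv_mul_cancel_left₀ ha]
  induction n using Int.induction_on generalizing j with
  | zero => simp
  | succ n ih => rw [zpow_add_one, mul_smul, ih, h1, zpow_add_one₀ ha, mul_assoc]
  | pred n ih => rw [zpow_sub_one, mul_smul, ih, h2, zpow_sub_one₀ ha, mul_assoc]

/-- The affine action of `J ⋊ ℤ` on Sol³ given by two equivariant additive maps `J → ℝ`. -/
noncomputable def affineAction (hα : IsQuadraticUnit α) {J : Ideal (ZAdjoin α)} (s t : J →+ ℝ)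
    {a b : ℝ} (ha : a ≠ 0) (hb : b ≠ 0) (hs : ∀ j : J, s (hα.gen • j) = a * s j)
    (ht : ∀ j : J, t (hα.gen • j) = b * t j) : hα.SolGroup J →* Equiv.Perm Sol3 :=
  MonoidHom.toHomPerm
    -- The shift of `z` by `-n log|a|` offsets the factor `a ^ (2n)` in `e^{2z}dx²`, and also `b ^
    -- (2n)` in `e^{-2z}dy²` once `|ab| = 1`.
    { toFun g p := (a ^ g.right.toAdd * p.1 + s g.left.toAdd,
        b ^ g.right.toAdd * p.2.1 + t g.left.toAdd, p.2.2 + -(g.right.toAdd * Real.log |a|))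
      map_one' := by
        funext p
        refine Prod.ext ?_ (Prod.ext ?_ ?_)
        · change a ^ (0 : ℤ) * p.1 + s 0 = p.1
          simp
        · change b ^ (0 : ℤ) * p.2.1 + t 0 = p.2.1
          simp
        · change p.2.2 + -(((0 : ℤ) : ℝ) * Real.log |a|) = p.2.2
          simp
      map_mul' := by
        rintro ⟨j, n⟩ ⟨k, m⟩
        have hs' := hα.map_unit_zpow_smul s ha hs n.toAdd k.toAdd
        have ht' := hα.map_unit_zpow_smul t hb ht n.toAdd k.toAdd
        funext p
        refine Prod.ext ?_ (Prod.ext ?_ ?_)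
        · change a ^ (n.toAdd + m.toAdd) * p.1 + s (j.toAdd + hα.unit ^ n.toAdd • k.toAdd) =
            a ^ n.toAdd * (a ^ m.toAdd * p.1 + s k.toAdd) + s j.toAdd
          rw [map_add, hs', zpow_add₀ ha]
          ring
        · change b ^ (n.toAdd + m.toAdd) * p.2.1 + t (j.toAdd + hα.unit ^ n.toAdd • k.toAdd) =
            b ^ n.toAdd * (b ^ m.toAdd * p.2.1 + t k.toAdd) + t j.toAdd
          rw [map_add, ht', zpow_add₀ hb]
          ring
        · change p.2.2 + -(((n.toAdd + m.toAdd : ℤ) : ℝ) * Real.log |a|) =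
            p.2.2 + -((m.toAdd : ℝ) * Real.log |a|) + -((n.toAdd : ℝ) * Real.log |a|)
          push_cast
          ring }

theorem affineAction_apply (hα : IsQuadraticUnit α) {J : Ideal (ZAdjoin α)} (s t : J →+ ℝ)
    {a b : ℝ} (ha : a ≠ 0) (hb : b ≠ 0) (hs : ∀ j : J, s (hα.gen • j) = a * s j)
    (ht : ∀ j : J, t (hα.gen • j) = b * t j) (g : hα.SolGroup J) (p : Sol3) :
    hα.affineAction s t ha hb hs ht g p = (a ^ g.right.toAdd * p.1 + s g.left.toAdd,
      b ^ g.right.toAdd * p.2.1 + t g.left.toAdd,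
      p.2.2 + -(g.right.toAdd * Real.log |a|)) := rfl

/-- `J ⋊ ℤ` is a Sol³-group when `J` is embedded equivariantly as a lattice in `ℝ²`. -/
theorem isSol3Group_of_lattice (hα : IsQuadraticUnit α) {J : Ideal (ZAdjoin α)} (s t : J →+ ℝ)
    {a b : ℝ} (ha : |a| ≠ 1) (hab : |a * b| = 1) (hs : ∀ j : J, s (hα.gen • j) = a * s j)
    (ht : ∀ j : J, t (hα.gen • j) = b * t j)
    (hinj : ∀ j, s j = 0 → j = 0)
    (hdisc : ∀ C : ℝ, {j : J | |s j| ≤ C ∧ |t j| ≤ C}.Finite)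
    (hcpt : ∃ C : ℝ, ∀ u v : ℝ, ∃ j : J, |u + s j| ≤ C ∧ |v + t j| ≤ C) :
    IsSol3Group (hα.SolGroup J) := by
  have hab0 : a * b ≠ 0 := fun h => by simp [h] at hab
  have ha0 : a ≠ 0 := left_ne_zero_of_mul hab0
  have hb0 : b ≠ 0 := right_ne_zero_of_mul hab0
  have hL : Real.log |a| ≠ 0 :=
    Real.log_ne_zero_of_pos_of_ne_one (abs_pos.2 ha0) ha
  have hLb : Real.log |b| = -Real.log |a| := by
    have := congrArg Real.log hab
    rw [abs_mul, Real.log_mul (abs_pos.2 ha0).ne' (abs_pos.2 hb0).ne', Real.log_one] at this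
    linarith
  have hexp : ∀ c : ℝ, c ≠ 0 → ∀ n : ℤ, Real.exp (2 * -(n * Real.log |c|)) * (c ^ n) ^ 2 = 1 := by
    intro c hc n
    have h1 : (c ^ n) ^ 2 = Real.exp (2 * (n * Real.log |c|)) := by
      rw [two_mul, Real.exp_add, ← sq, mul_comm, Real.exp_mul, Real.exp_log (abs_pos.2 hc),
        Real.rpow_intCast, ← abs_zpow, sq_abs]
    rw [h1, ← Real.exp_add, mul_neg, neg_add_cancel, Real.exp_zero]
  have hcd : ∀ g, ContDiff ℝ ∞ (hα.affineAction s t ha0 hb0 hs ht g) := fun g => by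
    have : (hα.affineAction s t ha0 hb0 hs ht g : Sol3 → Sol3) = fun p =>
      (a ^ g.right.toAdd * p.1 + s g.left.toAdd, b ^ g.right.toAdd * p.2.1 + t g.left.toAdd,
      p.2.2 + -(g.right.toAdd * Real.log |a|)) := rfl
    rw [this]
    fun_prop
  refine isSol3Group_of_hom (hα.affineAction s t ha0 hb0 hs ht) (fun g => ⟨hcd g, ?_, ?_⟩) ?_ ?_ ?_
  · have h := hcd g⁻¹
    rw [map_inv] at h
    exact h
  · refine Sol3.metric_fderiv_diagonal _ _ (hexp a ha0 _) ?_
    rw [← hexp b hb0 g.right.toAdd, hLb]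
    ring_nf
  · rintro ⟨j, n⟩ p hp
    rw [affineAction_apply] at hp
    have h3 := congrArg (fun q : Sol3 => q.2.2) hp
    have hn : n.toAdd = 0 := by
      have h4 : (n.toAdd : ℝ) * Real.log |a| = 0 := by linear_combination -h3
      exact_mod_cast (mul_eq_zero.1 h4).resolve_right hL
    have h1 := congrArg (fun q : Sol3 => q.1) hp
    have hj : j.toAdd = 0 := hinj _ (by simpa [hn] using h1)
    exact SemidirectProduct.ext (toAdd_eq_zero.1 hj) (toAdd_eq_zero.1 hn)
  · intro C
    -- Two points with `|z| ≤ C` differ by at most `2C` in height, which bounds `n`. For each such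
    -- `n`, the translation part is the difference of the image and the dilated point, which bounds
    -- `s j` and `t j`.
    set B : ℤ := ⌈2 * C / |Real.log (|a|)|⌉
    have hfin : (⋃ n ∈ Set.Icc (-B) B, (fun j : J => (⟨Multiplicative.ofAdd j,
        Multiplicative.ofAdd n⟩ : hα.SolGroup J)) ''
        {j : J | |s j| ≤ C + max (|a| ^ n) (|b| ^ n) * C ∧
          |t j| ≤ C + max (|a| ^ n) (|b| ^ n) * C}).Finite :=
      (Set.finite_Icc _ _).biUnion fun n _ => (hdisc _).image _
    refine hfin.subset ?_
    rintro ⟨j, n⟩ ⟨p, hp, hq⟩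
    rw [affineAction_apply] at hq
    simp only [Prod.norm_def, sup_le_iff, Real.norm_eq_abs] at hp hq
    obtain ⟨hp1, hp2, hp3⟩ := hp
    obtain ⟨hq1, hq2, hq3⟩ := hq
    have hC : 0 ≤ C := (abs_nonneg _).trans hp1
    have hn : |(n.toAdd : ℝ)| ≤ 2 * C / |Real.log (|a|)| := by
      rw [le_div_iff₀ (abs_pos.2 hL), ← abs_mul]
      have := abs_sub p.2.2 (p.2.2 + -(n.toAdd * Real.log |a|))
      rw [sub_add_cancel_left, neg_neg] at this
      linarith
    have hn' : |n.toAdd| ≤ B := by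
      have := hn.trans (Int.le_ceil _)
      exact_mod_cast this
    refine Set.mem_biUnion (x := n.toAdd) (abs_le.1 hn') ⟨j.toAdd, ⟨?_, ?_⟩, rfl⟩
    · have h := abs_sub (a ^ n.toAdd * p.1 + s j.toAdd) (a ^ n.toAdd * p.1)
      rw [add_sub_cancel_left, abs_mul, abs_zpow] at h
      have := mul_le_mul (le_max_left (|a| ^ n.toAdd) (|b| ^ n.toAdd)) hp1 (abs_nonneg _)
        (by positivity)
      linarith
    · have h := abs_sub (b ^ n.toAdd * p.2.1 + t j.toAdd) (b ^ n.toAdd * p.2.1)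
      rw [add_sub_cancel_left, abs_mul, abs_zpow] at h
      have := mul_le_mul (le_max_right (|a| ^ n.toAdd) (|b| ^ n.toAdd)) hp2 (abs_nonneg _)
        (by positivity)
      linarith
  · obtain ⟨C, hC⟩ := hcpt
    refine ⟨max C |Real.log (|a|)|, fun p => ?_⟩
    -- First `n` brings the height within `|log|a||`; then `j` is chosen for the already dilated
    -- point, since the translation acts last.
    set n : ℤ := round (p.2.2 / Real.log |a|)
    obtain ⟨j, hj1, hj2⟩ := hC (a ^ n * p.1) (b ^ n * p.2.1)
    refine ⟨⟨Multiplicative.ofAdd j, Multiplicative.ofAdd n⟩, ?_⟩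
    rw [affineAction_apply]
    simp only [Prod.norm_def, sup_le_iff, Real.norm_eq_abs, toAdd_ofAdd]
    refine ⟨hj1.trans (le_max_left _ _), hj2.trans (le_max_left _ _), le_trans ?_ (le_max_right _ _)⟩
    have h := abs_sub_round (p.2.2 / Real.log |a|)
    have : p.2.2 + -(n * Real.log |a|) = (p.2.2 / Real.log |a| - n) * Real.log |a| := by
      field_simp
      ring
    rw [this, abs_mul]
    exact mul_le_of_le_one_left (abs_nonneg _) (by linarith)

/-- A nonzero ideal of `ℤ[α]` is a lattice in `ℝ²`, by means of the two real embeddings. -/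
theorem isSol3Group (hα : IsQuadraticUnit α) (h1 : ∀ n : ℕ, 0 < n → α ^ n ≠ 1)
    {J : Ideal (ZAdjoin α)} (hJ : J ≠ ⊥) : IsSol3Group (hα.SolGroup J) := by
  obtain ⟨a, ha⟩ := hα.exists_real h1
  have hsq : a ^ 2 = hα.trace * a - hα.nrm := by
    have h : (a : ℂ) ^ 2 = hα.trace * a - hα.nrm := ha ▸ hα.sq_eq
    exact_mod_cast h
  obtain ⟨b, hb⟩ : ∃ b : ℝ, b = hα.trace - a := ⟨_, rfl⟩
  have hab : a * b = hα.nrm := by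
    rw [hb]
    linear_combination -hsq
  have hne : a - b ≠ 0 := by
    have hD : ((hα.trace ^ 2 - 4 * hα.nrm : ℤ) : ℝ) ≠ 0 := by exact_mod_cast (hα.discrim_pos h1).ne'
    intro h
    apply hD
    push_cast
    rw [hb] at h
    linear_combination (2 * a - hα.trace) * h - 4 * hsq
  let re : ZAdjoin α →+ ℝ := Complex.reAddGroupHom.comp (ZAdjoin α).toSubring.subtype.toAddMonoidHom
  have hre : ∀ m n : ℤ, re (m + n * hα.gen) = m + n * a := fun m n => by
    have : (((m + n * hα.gen : ZAdjoin α) : ℂ)) = ((m + n * a : ℝ) : ℂ) := by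
      simp [coe_gen, ← ha]
    change Complex.re ((m + n * hα.gen : ZAdjoin α) : ℂ) = _
    rw [this, Complex.ofReal_re]
  have hre' : ∀ m n : ℤ, re (hα.conj (m + n * hα.gen)) = m + n * b := fun m n => by
    have h : hα.conj (m + n * hα.gen) = (m + n * hα.trace : ℤ) + (-n : ℤ) * hα.gen := by
      simp only [map_add, map_mul, map_intCast, conj_gen]
      push_cast
      ring
    rw [h, hre, hb]
    push_cast
    ring
  let s : J →+ ℝ := re.comp J.subtype.toAddMonoidHom
  -- The second real embedding is the first one after the Galois involution.
  let t : J →+ ℝ := re.comp ((hα.conj : ZAdjoin α →+ ZAdjoin α).comp J.subtype.toAddMonoidHom)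
  have hst : ∀ j : J, ∃ m n : ℤ, (j : ZAdjoin α) = m + n * hα.gen ∧ s j = m + n * a ∧
      t j = m + n * b := fun j => by
    obtain ⟨m, n, h⟩ := hα.exists_eq_add_mul_gen (j : ZAdjoin α)
    refine ⟨m, n, h, ?_, ?_⟩
    · rw [← hre, ← h]; rfl
    · rw [← hre', ← h]; rfl
  have hgen : ∀ m n : ℤ, hα.gen * (m + n * hα.gen) =
      (-(n * hα.nrm) : ℤ) + (m + n * hα.trace : ℤ) * hα.gen := fun m n => by
    push_cast
    linear_combination (n : ZAdjoin α) * hα.gen_sq_eq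
  refine hα.isSol3Group_of_lattice s t (a := a) (b := b) ?_ ?_ ?_ ?_ ?_ ?_ ?_
  · intro h
    refine h1 2 two_pos ?_
    rw [← ha, ← Complex.ofReal_pow, ← sq_abs, h]
    norm_num
  · rw [hab]
    rcases hα.nrm_eq with h | h <;> simp [h]
  · intro j
    obtain ⟨m, n, hj, hs, -⟩ := hst j
    have : s (hα.gen • j) = re (hα.gen * (j : ZAdjoin α)) := rfl
    rw [this, hs, hj, hgen, hre]
    push_cast
    linear_combination -(n : ℝ) * hsq
  · intro j
    obtain ⟨m, n, hj, -, ht⟩ := hst j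
    have : t (hα.gen • j) = re (hα.conj (hα.gen * (j : ZAdjoin α))) := rfl
    rw [this, ht, hj, hgen, hre']
    push_cast
    rw [hb]
    linear_combination -(n : ℝ) * hsq
  · intro j h
    obtain ⟨m, n, hj, hs, -⟩ := hst j
    have : (m : ℂ) + n * α = 0 := by
      rw [← ha]
      exact_mod_cast congrArg (fun x : ℝ => (x : ℂ)) (hs.symm.trans h)
    obtain ⟨rfl, rfl⟩ := hα.eq_zero_of_add_mul_eq_zero this
    exact Subtype.ext (by simpa using hj)
  · intro C
    -- Subtracting the embeddings `m + na` and `m + nb` leaves `n(a - b)`, which bounds `n` and then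
    -- `m`.
    set B : ℤ := ⌈2 * C / |a - b|⌉
    set D : ℤ := ⌈C + B * |a|⌉
    have hfin := ((Set.finite_Icc (-D) D).prod (Set.finite_Icc (-B) B)).image
      fun q : ℤ × ℤ => (q.1 : ZAdjoin α) + q.2 * hα.gen
    refine Set.Finite.of_finite_image (f := Subtype.val) (hfin.subset ?_)
      Subtype.val_injective.injOn
    rintro _ ⟨j, ⟨hsj, htj⟩, rfl⟩
    obtain ⟨m, n, hj, hs, ht⟩ := hst j
    rw [hs] at hsj
    rw [ht] at htj
    have hn : |(n : ℝ)| ≤ 2 * C / |a - b| := by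
      rw [le_div_iff₀ (abs_pos.2 hne), ← abs_mul]
      have := abs_sub (m + n * a) (m + n * b)
      rw [show (m + n * a) - (m + n * b) = n * (a - b) by ring] at this
      linarith
    have hn1 := hn.trans (Int.le_ceil _)
    have hm : |(m : ℝ)| ≤ C + B * |a| := by
      have := abs_sub (m + n * a) (n * a)
      rw [add_sub_cancel_right, abs_mul (n : ℝ)] at this
      have := mul_le_mul_of_nonneg_right hn1 (abs_nonneg a)
      linarith
    have hm1 := hm.trans (Int.le_ceil _)
    have hn2 : |n| ≤ B := by exact_mod_cast hn1
    have hm2 : |m| ≤ D := by exact_mod_cast hm1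
    exact ⟨(m, n), ⟨abs_le.1 hm2, abs_le.1 hn2⟩, hj.symm⟩
  · obtain ⟨N, hN, hNJ⟩ := hα.exists_int_mem hJ
    have hN' : (N : ℝ) ≠ 0 := by exact_mod_cast hN
    refine ⟨|(N : ℝ)| * (1 + |a| + |b|), fun u v => ?_⟩
    -- The real solution of `N(x + ya) = u`, `N(x + yb) = v`. Rounding `x` and `y` gives a point of
    -- `N ℤ[α] ⊆ J` near `(u, v)`.
    obtain ⟨y, hy⟩ : ∃ y : ℝ, y = (u - v) / (a - b) / N := ⟨_, rfl⟩
    obtain ⟨x, hx⟩ : ∃ x : ℝ, x = u / N - y * a := ⟨_, rfl⟩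
    have hu : u = N * (x + y * a) := by rw [hx]; field_simp; ring
    have hv : v = N * (x + y * b) := by
      have : y * (a - b) * N = u - v := by rw [hy]; field_simp
      linear_combination hu + this
    have hj : ((-round x : ℤ) + (-round y : ℤ) * hα.gen) * (N : ZAdjoin α) ∈ J :=
      J.mul_mem_left _ hNJ
    have hj' : ((-round x : ℤ) + (-round y : ℤ) * hα.gen) * (N : ZAdjoin α) =
        (-round x * N : ℤ) + (-round y * N : ℤ) * hα.gen := by
      push_cast
      ring
    have hxr := abs_sub_round x
    have hyr := abs_sub_round y
    have key : ∀ c : ℝ, |N * (x + y * c) + ((-round x * N : ℤ) + (-round y * N : ℤ) * c)| ≤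
        |(N : ℝ)| * (1 + |c|) := fun c => by
      have h : N * (x + y * c) + ((-round x * N : ℤ) + (-round y * N : ℤ) * c) =
          N * ((x - round x) + (y - round y) * c) := by
        push_cast
        ring
      rw [h, abs_mul]
      gcongr
      refine (abs_add_le _ _).trans ?_
      rw [abs_mul]
      gcongr
      · linarith
      · exact mul_le_of_le_one_left (abs_nonneg _) (by linarith)
    refine ⟨⟨_, hj⟩, ?_, ?_⟩
    · have : s ⟨_, hj⟩ = re (((-round x : ℤ) + (-round y : ℤ) * hα.gen) * (N : ZAdjoin α)) := rfl
      rw [this, hj', hre, hu]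
      refine (key a).trans ?_
      exact mul_le_mul_of_nonneg_left (by linarith [abs_nonneg b]) (abs_nonneg _)
    · have : t ⟨_, hj⟩ =
        re (hα.conj (((-round x : ℤ) + (-round y : ℤ) * hα.gen) * (N : ZAdjoin α))) := rfl
      rw [this, hj', hre', hv]
      refine (key b).trans ?_
      exact mul_le_mul_of_nonneg_left (by linarith [abs_nonneg a]) (abs_nonneg _)

end IsQuadraticUnit

/-! ### Isomorphisms of the groups and equivariant isomorphisms of the ideals. -/

namespace IsQuadraticUnit

variable {α β : ℂ}

/-- The inclusion of an ideal of `ℤ[α]` in `ℂ`. -/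
def idealCoe (J : Ideal (ZAdjoin α)) : J →+ ℂ :=
  (ZAdjoin α).toSubring.subtype.toAddMonoidHom.comp J.subtype.toAddMonoidHom

theorem idealCoe_apply {J : Ideal (ZAdjoin α)} (j : J) : idealCoe J j = ((j : ZAdjoin α) : ℂ) := rfl

theorem idealCoe_smul {J : Ideal (ZAdjoin α)} (r : ZAdjoin α) (j : J) :
    idealCoe J (r • j) = r * idealCoe J j := rfl

theorem idealCoe_injective (J : Ideal (ZAdjoin α)) : Function.Injective (idealCoe J) :=
  Subtype.val_injective.comp Subtype.val_injective

theorem idealCoe_zpow_smul (hα : IsQuadraticUnit α) {J : Ideal (ZAdjoin α)} (n : ℤ) (j : J) :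
    idealCoe J (hα.unit ^ n • j) = α ^ n * idealCoe J j :=
  hα.map_unit_zpow_smul (idealCoe J) hα.ne_zero (fun _ => rfl) n j

/-- There is an additive isomorphism `J ≃ K` which carries multiplication by `α` to
multiplication by `γ`. -/
def EquivariantIso (hα : IsQuadraticUnit α) (J : Ideal (ZAdjoin α)) (K : Ideal (ZAdjoin β))
    (γ : ℂ) : Prop :=
  ∃ ψ : J ≃+ K, ∀ j : J, idealCoe K (ψ (hα.gen • j)) = γ * idealCoe K (ψ j)

theorem nonempty_mulEquiv_of_equivariantIso (hα : IsQuadraticUnit α) (hβ : IsQuadraticUnit β)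
    {J : Ideal (ZAdjoin α)} {K : Ideal (ZAdjoin β)} {γ : ℂ} (hγ : γ = β ∨ γ = β⁻¹)
    (h : hα.EquivariantIso J K γ) : Nonempty (hα.SolGroup J ≃* hβ.SolGroup K) := by
  obtain ⟨ψ, hψ⟩ := h
  -- Both cases are treated at once: `f` is multiplication by `e = ±1` on `ℤ`.
  obtain ⟨f, e, hf, rfl⟩ : ∃ (f : Multiplicative ℤ ≃* Multiplicative ℤ) (e : ℤ),
      (∀ n, (f n).toAdd = e * n.toAdd) ∧ γ = β ^ e := by
    rcases hγ with rfl | rfl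
    · exact ⟨MulEquiv.refl _, 1, by simp, by simp⟩
    · exact ⟨MulEquiv.inv _, -1, by simp, by simp⟩
  refine ⟨SemidirectProduct.congr (AddEquiv.toMultiplicative ψ) f fun n => ?_⟩
  refine MulEquiv.ext fun j => ?_
  have h1 := hα.map_unit_zpow_smul ((idealCoe K).comp ψ.toAddMonoidHom)
    (zpow_ne_zero e hβ.ne_zero) hψ n.toAdd j.toAdd
  have h2 := hβ.idealCoe_zpow_smul (f n).toAdd (ψ j.toAdd)
  have h3 : ψ (hα.unit ^ n.toAdd • j.toAdd) = hβ.unit ^ (f n).toAdd • ψ j.toAdd := by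
    apply idealCoe_injective K
    rw [h2, hf, zpow_mul]
    exact h1
  exact congrArg Multiplicative.ofAdd h3

/-- This is the minimal polynomial at `1`. If it vanished, the roots would be `1` and `τ - 1`, and
`α` would be rational. -/
theorem one_sub_trace_add_nrm_ne_zero (hα : IsQuadraticUnit α) :
    1 - hα.trace + hα.nrm ≠ 0 := by
  intro h
  have h' : (1 : ℂ) - hα.trace + hα.nrm = 0 := by exact_mod_cast h
  have h1 : (α - 1) * (α + 1 - hα.trace) = 0 := by linear_combination hα.sq_eq - h'
  rcases mul_eq_zero.1 h1 with h | h
  · exact hα.ne_ratCast 1 (by push_cast; linear_combination h)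
  · exact hα.ne_ratCast (hα.trace - 1) (by push_cast; linear_combination h)

theorem gen_sq_smul (hα : IsQuadraticUnit α) {J : Ideal (ZAdjoin α)} (j : J) :
    hα.gen • hα.gen • j = hα.trace • hα.gen • j - hα.nrm • j := by
  apply Subtype.ext
  change hα.gen * (hα.gen * (j : ZAdjoin α)) = hα.trace • (hα.gen * (j : ZAdjoin α)) -
    hα.nrm • (j : ZAdjoin α)
  rw [zsmul_eq_mul, zsmul_eq_mul]
  linear_combination (j : ZAdjoin α) * hα.gen_sq_eq

theorem inr_mul_inl_mul_inv (hα : IsQuadraticUnit α) {J : Ideal (ZAdjoin α)} (j : J) :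
    (SemidirectProduct.inr (Multiplicative.ofAdd 1) * SemidirectProduct.inl (Multiplicative.ofAdd j)
      * (SemidirectProduct.inr (Multiplicative.ofAdd 1))⁻¹ : hα.SolGroup J) =
    SemidirectProduct.inl (Multiplicative.ofAdd (hα.gen • j)) := by
  rw [← map_inv, ← SemidirectProduct.inl_aut, action_apply, zpow_one]
  rfl

/-- As `N` is commutative, the `N`-component of `g` has no effect. Hence the `K`-component of the
image of the generator of `ℤ` is irrelevant below. -/
theorem _root_.SemidirectProduct.mul_inl_mul_inv {N G : Type*} [CommGroup N] [Group G]
    {φ : G →* MulAut N} (g : N ⋊[φ] G) (x : N) :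
    g * SemidirectProduct.inl x * g⁻¹ = SemidirectProduct.inl (φ g.right x) := by
  have h : SemidirectProduct.inl (φ := φ) (φ g.right x) =
      SemidirectProduct.inl g.left * SemidirectProduct.inl (φ g.right x) *
        (SemidirectProduct.inl g.left)⁻¹ := by
    rw [← map_inv, ← map_mul, ← map_mul, mul_inv_cancel_comm]
  conv_lhs => rw [← SemidirectProduct.inl_left_mul_inr_right g]
  rw [h, SemidirectProduct.inl_aut, map_inv]
  group

/-- Every homomorphism from `J ⋊ ℤ` to `ℤ` vanishes on `J`. -/
theorem map_inl_eq_one (hα : IsQuadraticUnit α) {J : Ideal (ZAdjoin α)}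
    (f : hα.SolGroup J →* Multiplicative ℤ) (j : Multiplicative J) :
    f (SemidirectProduct.inl j) = 1 := by
  let F : J →+ ℤ := MonoidHom.toAdditive (f.comp SemidirectProduct.inl)
  have hF : ∀ j : J, F (hα.gen • j) = F j := fun j => by
    have h := congrArg f (hα.inr_mul_inl_mul_inv j)
    rw [map_mul, map_mul, map_inv, mul_inv_cancel_comm] at h
    exact congrArg Multiplicative.toAdd h.symm
  -- Since `F` is invariant under `α`, the relation `α²j = ταj - εj` becomes `(1 - τ + ε) F j = 0`.
  have h := congrArg F (hα.gen_sq_smul j.toAdd)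
  rw [map_sub, map_zsmul, map_zsmul, hF, hF, smul_eq_mul, smul_eq_mul] at h
  have h' : (1 - hα.trace + hα.nrm) * F j.toAdd = 0 := by linear_combination h
  exact (mul_eq_zero.1 h').resolve_left hα.one_sub_trace_add_nrm_ne_zero

/-- The `ℤ`-component of `f` is a homomorphism to `ℤ`, so it is trivial on `J`. Used for an
isomorphism and its inverse, this gives `J ≃ K`. -/
theorem exists_inl_eq (hα : IsQuadraticUnit α) (hβ : IsQuadraticUnit β)
    {J : Ideal (ZAdjoin α)} {K : Ideal (ZAdjoin β)} (f : hα.SolGroup J →* hβ.SolGroup K)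
    (j : Multiplicative J) :
    f (SemidirectProduct.inl j) = SemidirectProduct.inl (f (SemidirectProduct.inl j)).left :=
  SemidirectProduct.ext rfl (hα.map_inl_eq_one (SemidirectProduct.rightHom.comp f) j)

theorem equivariantIso_of_mulEquiv (hα : IsQuadraticUnit α) (hβ : IsQuadraticUnit β)
    {J : Ideal (ZAdjoin α)} {K : Ideal (ZAdjoin β)} (e : hα.SolGroup J ≃* hβ.SolGroup K) :
    hα.EquivariantIso J K β ∨ hα.EquivariantIso J K β⁻¹ := by
  have he := hα.exists_inl_eq hβ e.toMonoidHom
  have he' := hβ.exists_inl_eq hα e.symm.toMonoidHom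
  let ψ : Multiplicative J ≃* Multiplicative K :=
    { toFun j := (e (SemidirectProduct.inl j)).left
      invFun k := (e.symm (SemidirectProduct.inl k)).left
      left_inv j := by
        have h := he j
        change e _ = SemidirectProduct.inl (e (SemidirectProduct.inl j)).left at h
        dsimp only
        rw [← h, MulEquiv.symm_apply_apply, SemidirectProduct.left_inl]
      right_inv k := by
        have h := he' k
        change e.symm _ = SemidirectProduct.inl (e.symm (SemidirectProduct.inl k)).left at h
        dsimp only
        rw [← h, MulEquiv.apply_symm_apply, SemidirectProduct.left_inl]
      map_mul' i j := by
        apply SemidirectProduct.inl_injective (φ := hβ.action K)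
        have h1 := he i
        have h2 := he j
        have h3 := he (i * j)
        change e _ = SemidirectProduct.inl (e (SemidirectProduct.inl i)).left at h1
        change e _ = SemidirectProduct.inl (e (SemidirectProduct.inl j)).left at h2
        change e _ = SemidirectProduct.inl (e (SemidirectProduct.inl (i * j))).left at h3
        rw [map_mul SemidirectProduct.inl (e (SemidirectProduct.inl i)).left, ← h1, ← h2, ← h3,
          map_mul, map_mul] }
  have hψ : ∀ j, e (SemidirectProduct.inl j) = SemidirectProduct.inl (ψ j) := he
  let t : hα.SolGroup J := SemidirectProduct.inr (Multiplicative.ofAdd 1)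
  let n : ℤ := (e t).right.toAdd
  have hn : n = 1 ∨ n = -1 := by
    -- All `ℤ`-components in the image of `e` are multiples of `n`; as `e` is onto, `1` is one of
    -- them, so `n = ±1`.
    have hr : ∀ g : hα.SolGroup J, (e g).right.toAdd = n * g.right.toAdd := fun g => by
      have hg : g = SemidirectProduct.inl g.left * t ^ g.right.toAdd := by
        conv_lhs => rw [← SemidirectProduct.inl_left_mul_inr_right g]
        congr 1
        rw [← map_zpow, ← Int.ofAdd_mul, one_mul, ofAdd_toAdd]
      conv_lhs => rw [hg, map_mul, map_zpow, hψ]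
      have : ((SemidirectProduct.inl (ψ g.left) * e t ^ g.right.toAdd : hβ.SolGroup K)).right =
          SemidirectProduct.rightHom (e t) ^ g.right.toAdd := by
        rw [SemidirectProduct.mul_right, SemidirectProduct.right_inl, one_mul]
        exact map_zpow SemidirectProduct.rightHom _ _
      rw [this, toAdd_zpow, smul_eq_mul, mul_comm]
      rfl
    have h1 := hr (e.symm (SemidirectProduct.inr (Multiplicative.ofAdd 1)))
    rw [MulEquiv.apply_symm_apply, SemidirectProduct.right_inr, toAdd_ofAdd] at h1
    exact Int.isUnit_iff.1 (IsUnit.of_mul_eq_one _ h1.symm)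
  have hact : ∀ j : J, idealCoe K (ψ (Multiplicative.ofAdd (hα.gen • j))).toAdd =
      β ^ n * idealCoe K (ψ (Multiplicative.ofAdd j)).toAdd := fun j => by
    have h := congrArg e (hα.inr_mul_inl_mul_inv j)
    rw [map_mul, map_mul, map_inv, hψ, hψ] at h
    have h' : ψ (Multiplicative.ofAdd (hα.gen • j)) =
        hβ.action K (Multiplicative.ofAdd n) (ψ (Multiplicative.ofAdd j)) :=
      SemidirectProduct.inl_injective (h.symm.trans ((e t).mul_inl_mul_inv _))
    rw [h', ← hβ.idealCoe_zpow_smul]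
    rfl
  have hiso : hα.EquivariantIso J K (β ^ n) := ⟨MulEquiv.toAdditive ψ, hact⟩
  rcases hn with hn | hn <;> rw [hn] at hiso
  · exact Or.inl (by simpa using hiso)
  · exact Or.inr (by simpa using hiso)

/-! ### Equivariant isomorphisms and ideal classes. -/

/-- Transporting `α²j = ταj - εj` through `ψ` for one `j ≠ 0` shows that `γ` is a root of the
minimal polynomial of `α`. -/
theorem EquivariantIso.eq_or_eq {hα : IsQuadraticUnit α} {J : Ideal (ZAdjoin α)}
    {K : Ideal (ZAdjoin β)} {γ : ℂ} (h : hα.EquivariantIso J K γ) (hJ : J ≠ ⊥) :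
    γ = α ∨ γ = hα.conjRoot := by
  obtain ⟨ψ, hψ⟩ := h
  obtain ⟨x, hx, hx0⟩ := J.ne_bot_iff.1 hJ
  let j : J := ⟨x, hx⟩
  let s : J →+ ℂ := (idealCoe K).comp ψ.toAddMonoidHom
  have hs : ∀ j, s (hα.gen • j) = γ * s j := hψ
  have hj : s j ≠ 0 := by
    rw [map_ne_zero_iff s ((idealCoe_injective K).comp ψ.injective)]
    exact fun h => hx0 (congrArg Subtype.val h)
  have h := congrArg s (hα.gen_sq_smul j)
  rw [map_sub, map_zsmul, map_zsmul, hs, hs, zsmul_eq_mul, zsmul_eq_mul] at h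
  have h2 : γ ^ 2 = hα.trace * γ - hα.nrm := by
    apply mul_right_cancel₀ hj
    linear_combination h
  have h3 : (γ - α) * (γ - hα.conjRoot) = 0 := by
    rw [conjRoot_eq]
    linear_combination h2 - hα.sq_eq
  exact (mul_eq_zero.1 h3).imp sub_eq_zero.1 sub_eq_zero.1

/-- Composition with the Galois involution. -/
theorem equivariantIso_conjRoot_iff (hα : IsQuadraticUnit α) (J : Ideal (ZAdjoin α))
    (K : Ideal (ZAdjoin β)) :
    hα.EquivariantIso J K hα.conjRoot ↔ hα.EquivariantIso (J.map hα.conj) K α := by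
  have hmem : ∀ x : ZAdjoin α, x ∈ J.map hα.conj ↔ hα.conj x ∈ J := fun x => by
    constructor
    · intro h
      obtain ⟨y, hy, rfl⟩ := (Ideal.mem_map_iff_of_surjective hα.conj hα.conj.surjective).1 h
      rwa [conj_conj]
    · intro h
      rw [← hα.conj_conj x]
      exact Ideal.mem_map_of_mem _ h
  let c : J ≃+ J.map hα.conj :=
    { toFun j := ⟨hα.conj j, (hmem _).2 (by rw [conj_conj]; exact j.2)⟩
      invFun i := ⟨hα.conj i, (hmem _).1 i.2⟩
      left_inv j := Subtype.ext (hα.conj_conj _)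
      right_inv i := Subtype.ext (hα.conj_conj _)
      map_add' i j := Subtype.ext (map_add hα.conj _ _) }
  -- The involution turns multiplication by `α` into multiplication by `τ - α`.
  have hc : ∀ j : J, c (hα.gen • j) = hα.trace • c j - hα.gen • c j := fun j => by
    apply Subtype.ext
    change hα.conj (hα.gen * j) = hα.trace • hα.conj j - hα.gen * hα.conj j
    rw [map_mul, conj_gen, zsmul_eq_mul, sub_mul]
  have hc' : ∀ i : J.map hα.conj, c.symm (hα.gen • i) =
      hα.trace • c.symm i - hα.gen • c.symm i := fun i => by
    rw [AddEquiv.symm_apply_eq, map_sub, map_zsmul, hc]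
    simp
  constructor
  · rintro ⟨ψ, hψ⟩
    let s : J →+ ℂ := (idealCoe K).comp ψ.toAddMonoidHom
    have hs : ∀ j, s (hα.gen • j) = hα.conjRoot * s j := hψ
    refine ⟨c.symm.trans ψ, fun i => ?_⟩
    change s (c.symm (hα.gen • i)) = α * s (c.symm i)
    rw [hc', map_sub, map_zsmul, hs, conjRoot_eq, zsmul_eq_mul]
    ring
  · rintro ⟨ψ, hψ⟩
    let s : J.map hα.conj →+ ℂ := (idealCoe K).comp ψ.toAddMonoidHom
    have hs : ∀ j, s (hα.gen • j) = α * s j := hψ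
    refine ⟨c.trans ψ, fun i => ?_⟩
    change s (c (hα.gen • i)) = hα.conjRoot * s (c i)
    rw [hc, map_sub, map_zsmul, hs, conjRoot_eq, zsmul_eq_mul]
    ring

theorem map_smul_of_map_gen_smul (hα : IsQuadraticUnit α) {J : Ideal (ZAdjoin α)} (s : J →+ ℂ)
    (hs : ∀ j, s (hα.gen • j) = α * s j) (r : ZAdjoin α) (j : J) : s (r • j) = r * s j := by
  obtain ⟨m, n, rfl⟩ := hα.exists_eq_add_mul_gen r
  have h : ((m : ZAdjoin α) + n * hα.gen) • j = m • j + n • hα.gen • j := by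
    rw [add_smul, mul_smul, Int.cast_smul_eq_zsmul, Int.cast_smul_eq_zsmul]
  rw [h, map_add, map_zsmul, map_zsmul, hs, zsmul_eq_mul, zsmul_eq_mul]
  simp [coe_gen]
  ring

theorem coe_equivOfEq (h : ZAdjoin α = ZAdjoin β) (x : ZAdjoin α) :
    ((Subalgebra.equivOfEq (ZAdjoin α) (ZAdjoin β) h x : ZAdjoin β) : ℂ) = x := by
  rw [Subalgebra.equivOfEq_apply]

/-- Transport of an ideal along an equality `ℤ[α] = ℤ[β]`. -/
def comapAddEquiv (K : Ideal (ZAdjoin β)) (h : ZAdjoin α = ZAdjoin β) :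
    K.comap (Subalgebra.equivOfEq (ZAdjoin α) (ZAdjoin β) h) ≃+ K where
  toFun x := ⟨Subalgebra.equivOfEq (ZAdjoin α) (ZAdjoin β) h x, Ideal.mem_comap.1 x.2⟩
  invFun y := ⟨(Subalgebra.equivOfEq (ZAdjoin α) (ZAdjoin β) h).symm y, by
    rw [Ideal.mem_comap, AlgEquiv.apply_symm_apply]; exact y.2⟩
  left_inv x := Subtype.ext (AlgEquiv.symm_apply_apply _ _)
  right_inv y := Subtype.ext (AlgEquiv.apply_symm_apply _ _)
  map_add' x y := idealCoe_injective K (by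
    rw [map_add]; exact map_add (idealCoe _) x y)

theorem coe_comapAddEquiv (K : Ideal (ZAdjoin β)) (h : ZAdjoin α = ZAdjoin β)
    (x : K.comap (Subalgebra.equivOfEq (ZAdjoin α) (ZAdjoin β) h)) :
    (comapAddEquiv K h x : ZAdjoin β) = Subalgebra.equivOfEq (ZAdjoin α) (ZAdjoin β) h x := rfl

theorem idealCoe_comapAddEquiv (K : Ideal (ZAdjoin β)) (h : ZAdjoin α = ZAdjoin β)
    (x : K.comap (Subalgebra.equivOfEq (ZAdjoin α) (ZAdjoin β) h)) :
    idealCoe K (comapAddEquiv K h x) = idealCoe _ x := by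
  rw [idealCoe_apply, idealCoe_apply, coe_comapAddEquiv, coe_equivOfEq]

theorem idealCoe_comapAddEquiv_symm (K : Ideal (ZAdjoin β)) (h : ZAdjoin α = ZAdjoin β) (y : K) :
    idealCoe _ ((comapAddEquiv K h).symm y) = idealCoe K y := by
  rw [← idealCoe_comapAddEquiv, AddEquiv.apply_symm_apply]

theorem equivariantIso_of_sameIdealClass (hα : IsQuadraticUnit α) {J : Ideal (ZAdjoin α)}
    {K : Ideal (ZAdjoin β)} (hKJ : SameIdealClass K J) : hα.EquivariantIso J K α := by
  obtain ⟨h, ⟨ψ⟩⟩ := hKJ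
  refine ⟨ψ.symm.toAddEquiv.trans (comapAddEquiv K h), fun j => ?_⟩
  rw [AddEquiv.trans_apply, AddEquiv.trans_apply, idealCoe_comapAddEquiv, idealCoe_comapAddEquiv]
  have h' := congrArg (idealCoe _) (ψ.symm.map_smul hα.gen j)
  rwa [idealCoe_smul] at h'

theorem EquivariantIso.sameIdealClass {hα : IsQuadraticUnit α} {J : Ideal (ZAdjoin α)}
    {K : Ideal (ZAdjoin β)} (h : ZAdjoin α = ZAdjoin β) (hJK : hα.EquivariantIso J K α) :
    SameIdealClass K J := by
  obtain ⟨ψ, hψ⟩ := hJK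
  let s : J →+ ℂ := (idealCoe K).comp ψ.toAddMonoidHom
  have hr : ∀ (r : ZAdjoin α) (j : J), (comapAddEquiv K h).symm (ψ (r • j)) =
      r • (comapAddEquiv K h).symm (ψ j) := fun r j => by
    apply idealCoe_injective
    rw [idealCoe_smul, idealCoe_comapAddEquiv_symm, idealCoe_comapAddEquiv_symm]
    exact hα.map_smul_of_map_gen_smul s hψ r j
  exact ⟨h, ⟨((ψ.trans (comapAddEquiv K h).symm).toLinearEquiv hr).symm⟩⟩

/-- Dividing the quadratic equation by `α` gives `α = τ - εα⁻¹`, hence the reverse inclusion. -/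
theorem zAdjoin_inv (hα : IsQuadraticUnit α) : ZAdjoin α⁻¹ = ZAdjoin α := by
  apply le_antisymm
  · exact Algebra.adjoin_le (Set.singleton_subset_iff.2 hα.inv_mem)
  · have h : α = hα.trace - hα.nrm * α⁻¹ := by
      have := hα.ne_zero
      field_simp
      linear_combination hα.sq_eq
    exact Algebra.adjoin_le (Set.singleton_subset_iff.2 (Set.mem_of_eq_of_mem h
      (sub_mem (intCast_mem _ _)
        (mul_mem (intCast_mem _ _) (Algebra.self_mem_adjoin_singleton ℤ _)))))

theorem zAdjoin_conjRoot (hα : IsQuadraticUnit α) : ZAdjoin hα.conjRoot = ZAdjoin α := by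
  apply le_antisymm
  · exact Algebra.adjoin_le (Set.singleton_subset_iff.2 (hα.conj hα.gen).2)
  · have h : α = hα.trace - hα.conjRoot := by rw [conjRoot_eq]; ring
    exact Algebra.adjoin_le (Set.singleton_subset_iff.2 (Set.mem_of_eq_of_mem h
      (sub_mem (intCast_mem _ _) (Algebra.self_mem_adjoin_singleton ℤ _))))

end IsQuadraticUnit

/-! ### Finiteness of ideal classes, and the classification. -/

namespace IsQuadraticUnit

variable {α β : ℂ}

/-- There is a nonzero integer which lies in some representative of each ideal class of an order. -/
theorem exists_int_forall_exists_linearEquiv {S ι : Type*} [CommRing S] [IsDomain S] [Fintype ι]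
    [DecidableEq ι] (bS : Module.Basis ι ℤ S) :
    ∃ M : ℤ, (M : S) ≠ 0 ∧ ∀ J : Ideal S, J ≠ ⊥ →
      ∃ J' : Ideal S, (M : S) ∈ J' ∧ Nonempty (J ≃ₗ[S] J') := by
  have : Module.Finite ℤ S := Module.Finite.of_basis bS
  let adm := AbsoluteValue.absIsAdmissible
  set M : ℤ := ∏ m ∈ ClassGroup.finsetApprox bS adm, m
  have hM : (M : S) ≠ 0 := ClassGroup.prod_finsetApprox_ne_zero bS adm
  refine ⟨M, hM, fun J hJ => ?_⟩
  -- Take `b ≠ 0` in `J` of least absolute norm. For `a ∈ J`, some `ra - qb` with `r` dividing `M`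
  -- has smaller norm, so it is zero, and `b` divides `Ma`.
  obtain ⟨b, hb, hb0, hmin⟩ := ClassGroup.exists_min AbsoluteValue.abs
    ⟨J, mem_nonZeroDivisors_of_ne_zero hJ⟩
  have hdvd : ∀ a ∈ J, ∃ y, b * y = (M : S) * a := fun a ha => by
    obtain ⟨q, r, hr, hlt⟩ := ClassGroup.exists_mem_finset_approx' bS adm a hb0
    have h0 := hmin (r • a - q * b)
      (J.sub_mem (Submodule.smul_of_tower_mem J r ha) (J.mul_mem_left q hb)) hlt
    obtain ⟨k, hk⟩ := Finset.dvd_prod_of_mem (fun m : ℤ => m) hr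
    refine ⟨k * q, ?_⟩
    rw [zsmul_eq_mul] at h0
    have hk' : (M : S) = r * k := by exact_mod_cast congrArg (Int.cast : ℤ → S) hk
    rw [hk']
    linear_combination -(k : S) * h0
  have hbinj : Function.Injective (LinearMap.mulLeft S b) :=
    fun x y h => mul_left_cancel₀ hb0 h
  have hMinj : Function.Injective (LinearMap.mulLeft S (M : S)) :=
    fun x y h => mul_left_cancel₀ hM h
  -- This is `(M/b)J`, an ideal of `S` by the divisibility above; it contains `M` because `b ∈ J`.
  let J' : Ideal S :=
    Submodule.comap (LinearMap.mulLeft S b) (Submodule.map (LinearMap.mulLeft S (M : S)) J)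
  have hrange : Submodule.map (LinearMap.mulLeft S (M : S)) J =
      Submodule.map (LinearMap.mulLeft S b) J' := by
    rw [Submodule.map_comap_eq_of_le]
    rintro _ ⟨a, ha, rfl⟩
    obtain ⟨y, hy⟩ := hdvd a ha
    exact ⟨y, hy⟩
  refine ⟨J', ⟨b, hb, mul_comm _ _⟩, ⟨?_⟩⟩
  exact (Submodule.equivMapOfInjective _ hMinj J).trans
    ((LinearEquiv.ofEq _ _ hrange).trans (Submodule.equivMapOfInjective _ hbinj J').symm)

/-- Ideals containing `x` are determined by their images in `S/(x)`, which is a finite ring. -/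
theorem _root_.Ideal.finite_setOf_mem {S : Type*} [CommRing S] [IsDomain S] [Module.Free ℤ S]
    [Module.Finite ℤ S] {x : S} (hx : x ≠ 0) : Finite {J : Ideal S // x ∈ J} := by
  let I := Ideal.span {x}
  have : Finite (S ⧸ I) := I.finiteQuotientOfFreeOfNeBot (by simpa [I] using hx)
  have : Finite (Ideal (S ⧸ I)) := Finite.of_injective _ SetLike.coe_injective
  refine Finite.of_injective (fun J : {J : Ideal S // x ∈ J} => J.1.map (Ideal.Quotient.mk I))
    fun J K h => Subtype.ext ?_
  have hle : ∀ J : {J : Ideal S // x ∈ J}, I ≤ J.1 := fun J =>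
    (Ideal.span_singleton_le_iff_mem _).2 J.2
  rw [← Ideal.comap_map_mk (hle J), ← Ideal.comap_map_mk (hle K)]
  exact congrArg _ h

theorem finite_quotient_solGroupSetoid (hα : IsQuadraticUnit α) :
    Finite (Quotient hα.solGroupSetoid) := by
  let bS := (Algebra.adjoin.powerBasis' hα.isIntegral).basis
  have : Module.Finite ℤ (ZAdjoin α) := Module.Finite.of_basis bS
  have : Module.Free ℤ (ZAdjoin α) := Module.Free.of_basis bS
  obtain ⟨M, hM, h⟩ := exists_int_forall_exists_linearEquiv bS
  have := Ideal.finite_setOf_mem hM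
  refine Finite.of_surjective (fun J : {J : Ideal (ZAdjoin α) // (M : ZAdjoin α) ∈ J} =>
    (Quotient.mk hα.solGroupSetoid ⟨J.1, fun h => hM (by simpa [h] using J.2)⟩)) ?_
  rintro ⟨J, hJ⟩
  obtain ⟨J', hMJ', ⟨ψ⟩⟩ := h J hJ
  refine ⟨⟨J', hMJ'⟩, Quotient.sound ?_⟩
  refine hα.nonempty_mulEquiv_of_equivariantIso hα (Or.inl rfl) ⟨ψ.symm.toAddEquiv, fun j => ?_⟩
  exact (congrArg (idealCoe J) (ψ.symm.map_smul hα.gen j)).trans (idealCoe_smul _ _)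

/-- The multiplier `γ` is `β` or `β⁻¹` on the one hand, and `α` or its conjugate on the other; the
combinations are the cases of the statement. -/
theorem nonempty_mulEquiv_iff (hα : IsQuadraticUnit α) (hβ : IsQuadraticUnit β)
    {J : Ideal (ZAdjoin α)} {K : Ideal (ZAdjoin β)} (hJ : J ≠ ⊥) :
    Nonempty (hα.SolGroup J ≃* hβ.SolGroup K) ↔
      ((β = α ∨ β = α⁻¹) ∧ SameIdealClass K J) ∨
      ((β = hα.conjRoot ∨ β = hα.conjRoot⁻¹) ∧ SameIdealClass K (J.map hα.conj)) := by
  have hinv : ∀ {x y : ℂ}, x = y ∨ x = y⁻¹ → y = x ∨ y = x⁻¹ := by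
    rintro x y (rfl | rfl) <;> simp
  constructor
  · rintro ⟨e⟩
    obtain ⟨γ, hγ, hiso⟩ : ∃ γ, (γ = β ∨ γ = β⁻¹) ∧ hα.EquivariantIso J K γ := by
      rcases hα.equivariantIso_of_mulEquiv hβ e with h | h
      exacts [⟨β, Or.inl rfl, h⟩, ⟨β⁻¹, Or.inr rfl, h⟩]
    have hadj : ZAdjoin γ = ZAdjoin β := by
      rcases hγ with rfl | rfl
      exacts [rfl, hβ.zAdjoin_inv]
    rcases hiso.eq_or_eq hJ with h | h
    · rw [h] at hiso hadj hγ
      exact Or.inl ⟨hinv hγ, hiso.sameIdealClass hadj⟩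
    · rw [h] at hiso hadj hγ
      rw [equivariantIso_conjRoot_iff] at hiso
      exact Or.inr ⟨hinv hγ, hiso.sameIdealClass (hα.zAdjoin_conjRoot.symm.trans hadj)⟩
  · rintro (⟨hβα, h⟩ | ⟨hβα, h⟩)
    · exact hα.nonempty_mulEquiv_of_equivariantIso hβ (hinv hβα)
        (hα.equivariantIso_of_sameIdealClass h)
    · exact hα.nonempty_mulEquiv_of_equivariantIso hβ (hinv hβα)
        ((hα.equivariantIso_conjRoot_iff J K).2 (hα.equivariantIso_of_sameIdealClass h))

end IsQuadraticUnit

theorem theorem1 :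
    (∀ (α : ℂ) (hα : IsQuadraticUnit α), (∀ n : ℕ, 0 < n → α ^ n ≠ 1) →
      ∀ J : Ideal (ZAdjoin α), J ≠ ⊥ → IsSol3Group (hα.SolGroup J)) ∧
    (∀ (α β : ℂ) (hα : IsQuadraticUnit α) (hβ : IsQuadraticUnit β),
      (∀ n : ℕ, 0 < n → α ^ n ≠ 1) → (∀ n : ℕ, 0 < n → β ^ n ≠ 1) →
      ∀ (J : Ideal (ZAdjoin α)) (K : Ideal (ZAdjoin β)), J ≠ ⊥ → K ≠ ⊥ →
        (Nonempty (hα.SolGroup J ≃* hβ.SolGroup K) ↔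
          ((β = α ∨ β = α⁻¹) ∧ SameIdealClass K J) ∨
          ((β = hα.conjRoot ∨ β = hα.conjRoot⁻¹) ∧ SameIdealClass K (J.map hα.conj)))) ∧
    (∀ (α : ℂ) (hα : IsQuadraticUnit α), (∀ n : ℕ, 0 < n → α ^ n ≠ 1) →
      Finite (Quotient hα.solGroupSetoid)) := by
  exact ⟨fun α hα h1 J hJ => hα.isSol3Group h1 hJ,
    fun α β hα hβ _ _ J K hJ _ => hα.nonempty_mulEquiv_iff hβ hJ,
    fun α hα _ => hα.finite_quotient_solGroupSetoid⟩
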